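/- Conventions. A scheme $S$ is \emph{universally catenary} if it is locally Noetherian and every scheme locally of finite type over $S$ is catenary. For an integer $n$ (possibly negative), a morphism $h:V\to W$ has \emph{relative dimension at least $n$} if $V$ and $W$ are universally catenary, $h$ is locally of finite type, and for every irreducible closed $W'\subseteq W$ and every irreducible component $V'$ of $h^{-1}(W')$, with generic point $\eta$, $$\dim V'_{h(\eta)}-\operatorname{codim}_{W'}\overline{h(V')}\ \ge\ n,$$ where $V'_{h(\eta)}$ is the fiber of $V'$ over $h(\eta)$. It has \emph{universal relative dimension at least $n$} if for every universally catenary $W$-scheme $S$ the base change $V\times_W S\to S$ has relative dimension at least $n$. A morphism $h:V\to W$ of schemes has (universal) relative dimension at least $n$ \emph{at a point} $v\in V$ if there is an open neighborhood $U$ of $v$ such that $U\to W$ has (universal) relative dimension at least $n$. For a smooth morphism $f$, $\operatorname{reldim}_x f$ denotes the relative dimension of $f$ at the point $x$ of its source, i.e. the unique $m$ such that $f$ is smooth of relative dimension $m$ in a neighborhood of $x$. Proposition. Let $f:X\to Y$ be a smooth morphism of schemes and $g:Y\to Z$ a morphism of schemes with $Z$ universally catenary. Let $x\in X$ and $n\in\mathbb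 Z$. Then $g$ has relative dimension at least $n$ at $f(x)$ if and only if $g\circ f$ has relative dimension at least $n+\operatorname{reldim}_x f$ at $x$. Likewise, $g$ has universal relative dimension at least $n$ at $f(x)$ if and only if $g\circ f$ has universal relative dimension at least $n+\operatorname{reldim}_x f$ at $x$. -/

import Mathlib

open CategoryTheory CategoryTheory.Limits AlgebraicGeometry TopologicalSpace

universe u

namespace RelDim

/-- A topological space is catenary if for every inclusion `A ⊆ B` of irreducible closed subsets
the codimension of `A` in `B` is finite, and any two maximal (that is, saturated) chains of
irreducible closed subsets going from `A` to `B` have the same length. -/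
structure IsCatenary (T : Type u) [TopologicalSpace T] : Prop where
  finite_codim : ∀ A B : IrreducibleCloseds T, A ≤ B → Order.krullDim (Set.Icc A B) < ⊤
  length_eq : ∀ s t : RelSeries {(A, B) : IrreducibleCloseds T × IrreducibleCloseds T | A ⋖ B},
    s.head = t.head → s.last = t.last → s.length = t.length

/-- A scheme is universally catenary if it is locally Noetherian and every scheme locally of
finite type over it is catenary. -/
structure IsUniversallyCatenary (S : Scheme.{u}) : Prop where
  isLocallyNoetherian : IsLocallyNoetherian S
  isCatenary : ∀ (X : Scheme.{u}) (f : X ⟶ S), LocallyOfFiniteType f → IsCatenary X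

/-- The codimension `codim_B A` of `A` in `B`, for irreducible closed subsets `A ⊆ B` of a
topological space: the supremum of the lengths of the chains of irreducible closed subsets
lying between `A` and `B`. -/
noncomputable def codim {T : Type u} [TopologicalSpace T] (B A : Set T) : WithBot ℕ∞ :=
  Order.krullDim {C : IrreducibleCloseds T // A ⊆ (C : Set T) ∧ (C : Set T) ⊆ B}

/-- `f : X ⟶ Y` is a morphism locally of finite type of universally catenary schemes which has
relative dimension at least `n`: for every irreducible closed `Y' ⊆ Y` and every irreducible
component `X'` of `f⁻¹(Y')` (the space underlying the restriction of `X` to `Y'`), with generic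
point `η`, one has `dim X'_{f(η)} - codim_{Y'} (closure of f(X')) ≥ n`. Both the dimension of the
fiber (whose underlying space is `X' ∩ f⁻¹(f(η))`) and the codimension are required to be
natural numbers `d` and `c`. -/
structure HasRelDimGE {X Y : Scheme.{u}} (f : X ⟶ Y) (n : ℤ) : Prop where
  source : IsUniversallyCatenary X
  target : IsUniversallyCatenary Y
  locallyOfFiniteType : LocallyOfFiniteType f
  le_dim_sub_codim : ∀ (Y' : Set Y) (X' : Set X) (η : X), IsIrreducible Y' → IsClosed Y' →
    Maximal (fun T : Set X => IsIrreducible T ∧ T ⊆ f ⁻¹' Y') X' → IsGenericPoint η X' →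
    ∃ d c : ℕ, topologicalKrullDim ↥(X' ∩ f ⁻¹' {f η}) = (d : WithBot ℕ∞) ∧
      codim Y' (closure (f '' X')) = (c : WithBot ℕ∞) ∧ n ≤ (d : ℤ) - (c : ℤ)

/-- Universal relative dimension at least `n`: for every universally catenary `Y`-scheme `S`, the
base change `X ×_Y S ⟶ S` has relative dimension at least `n`. -/
def HasUnivRelDimGE {X Y : Scheme.{u}} (f : X ⟶ Y) (n : ℤ) : Prop :=
  ∀ (S : Scheme.{u}) (b : S ⟶ Y), IsUniversallyCatenary S → HasRelDimGE (pullback.snd f b) n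

/-- Relative dimension at least `n` at the point `x`. -/
def HasRelDimGEAt {X Y : Scheme.{u}} (f : X ⟶ Y) (n : ℤ) (x : X) : Prop :=
  ∃ U : X.Opens, x ∈ U ∧ HasRelDimGE (U.ι ≫ f) n

/-- Universal relative dimension at least `n` at the point `x`. -/
def HasUnivRelDimGEAt {X Y : Scheme.{u}} (f : X ⟶ Y) (n : ℤ) (x : X) : Prop :=
  ∃ U : X.Opens, x ∈ U ∧ HasUnivRelDimGE (U.ι ≫ f) n

/-- The relative dimension `reldim_x f` of a smooth morphism `f` at `x`: the natural number `m`
such that `f` is smooth of relative dimension `m` on an open neighborhood of `x`. For smooth `f`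
there is exactly one such `m`. -/
noncomputable def reldim {X Y : Scheme.{u}} (f : X ⟶ Y) (x : X) : ℕ :=
  sInf {m : ℕ | ∃ U : X.Opens, x ∈ U ∧ SmoothOfRelativeDimension m (U.ι ≫ f)}

/-- A smooth morphism is smooth of relative dimension `reldim f x` near `x`. -/
theorem reldim_spec {X Y : Scheme.{u}} (f : X ⟶ Y) [Smooth f] (x : X) :
    ∃ U : X.Opens, x ∈ U ∧ SmoothOfRelativeDimension (reldim f x) (U.ι ≫ f) := by
  refine Nat.sInf_mem (s := {m : ℕ | ∃ U : X.Opens, x ∈ U ∧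
    SmoothOfRelativeDimension m (U.ι ≫ f)}) ?_
  obtain ⟨U, hU, V, hV, hx, e, hf⟩ := Smooth.exists_isStandardSmooth f x
  algebraize [(f.appLE U V e).hom]
  obtain ⟨ι, σ, _, _, ⟨P⟩⟩ := hf
  have hd : (f.appLE U V e).hom.IsStandardSmoothOfRelativeDimension P.dimension :=
    P.isStandardSmoothOfRelativeDimension rfl
  refine ⟨P.dimension, V, hx, ⟨fun y => ?_⟩⟩
  have : IsAffine V.toScheme := hV
  refine ⟨U, hU, ⊤, isAffineOpen_top _, trivial,
    (V.ι_preimage_self.ge.trans (V.ι.preimage_mono e)), ?_⟩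
  rw [← Scheme.Hom.appLE_comp_appLE V.ι f U V ⊤ e V.ι_preimage_self.ge]
  have h0 : (V.ι.appLE V ⊤ V.ι_preimage_self.ge).hom.IsStandardSmoothOfRelativeDimension 0 :=
    RingHom.IsStandardSmoothOfRelativeDimension.equiv
      (asIso (V.ι.appLE V ⊤ V.ι_preimage_self.ge)).commRingCatIsoToRingEquiv
  rw [CommRingCat.hom_comp]
  have h1 := h0.comp hd
  rwa [Nat.zero_add] at h1

end RelDim

/-! The fibre dimension in the definition is a transcendence degree. If `h` is locally of finite
type, the part of the closure of `η` lying over `h η` has dimension `trdeg κ(η)/κ(h η)`, which is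
finite (`exists_topologicalKrullDim_closure_inter_fibre`). The closure of the image is the closure
of `h η`, so both terms of the inequality depend only on `η` (`hasRelDimGE_iff`).

Let `f` be smooth of relative dimension `m`. Transcendence degrees add along `f ≫ g`, and `f`
contributes exactly `m` at a point that is generic in its fibre. The codimension does not change,
since `η` and `f η` have the same image in `Z`. Because `f` is flat, generalizations lift, so `f`
sends generic points of components of the preimage of `Z'` in `X` to such points in `Y`. If `f` is
surjective, every such point of `Y` arises this way.

For the converse, `g` must also be shown to be locally of finite type, and this property descends
along smooth surjections. The universal version follows by base change, and the version at a point
by shrinking `X` and using that `f` is open. -/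

/-! ### Transcendence degree and dimension of algebras. -/

section Trdeg

/-- The transcendence degree does not change when passing to algebraic extensions of both rings. -/
theorem Algebra.trdeg_eq_of_isAlgebraic (R S K L : Type u) [CommRing R] [CommRing S] [CommRing K]
    [CommRing L] [Nontrivial R] [NoZeroDivisors K] [NoZeroDivisors L]
    [Algebra R S] [Algebra R K] [Algebra R L] [Algebra S L] [Algebra K L]
    [IsScalarTower R S L] [IsScalarTower R K L]
    [FaithfulSMul R S] [FaithfulSMul S L] [FaithfulSMul R K] [FaithfulSMul K L]
    [Algebra.IsAlgebraic R K] [Algebra.IsAlgebraic S L] :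
    Algebra.trdeg K L = Algebra.trdeg R S := by
  have h1 := _root_.trdeg_add_eq R S (A := L)
  have h2 := _root_.trdeg_add_eq R K (A := L)
  have : Nontrivial S := (FaithfulSMul.algebraMap_injective R S).nontrivial
  have : Nontrivial K := (FaithfulSMul.algebraMap_injective R K).nontrivial
  rw [trdeg_eq_zero (R := S), add_zero] at h1
  rw [trdeg_eq_zero, zero_add] at h2
  rw [h1, h2]

/-- The fraction field of `S` is quasi-finite over `R`, hence over the fraction field of `R`, and
quasi-finite over a field means finite. -/
theorem Algebra.QuasiFinite.isAlgebraic (R S : Type u) [CommRing R] [CommRing S] [IsDomain R]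
    [IsDomain S] [Algebra R S] [FaithfulSMul R S] [Algebra.QuasiFinite R S] :
    Algebra.IsAlgebraic R S := by
  let K := FractionRing R
  let L := FractionRing S
  have : Algebra.QuasiFinite R L := .trans R S L
  have : FaithfulSMul R L := FaithfulSMul.trans R S L
  let : Algebra K L := FractionRing.liftAlgebra R L
  have : IsScalarTower R K L := FractionRing.isScalarTower_liftAlgebra R L
  have : Algebra.QuasiFinite K L := .of_restrictScalars R K L
  have : Module.Finite K L := .of_quasiFinite
  have : Algebra.IsAlgebraic R K := IsLocalization.isAlgebraic K (nonZeroDivisors R)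
  have : Algebra.IsAlgebraic R L := Algebra.IsAlgebraic.trans R K L
  exact Algebra.IsAlgebraic.tower_bot_of_injective (IsFractionRing.injective S L)

/-- Integral extensions preserve the Krull dimension. -/
theorem ringKrullDim_eq_of_isIntegral (R S : Type u) [CommRing R] [CommRing S] [Algebra R S]
    [FaithfulSMul R S] [Algebra.IsIntegral R S] : ringKrullDim S = ringKrullDim R := by
  apply le_antisymm
  · refine Order.krullDim_le_of_strictMono (PrimeSpectrum.comap (algebraMap R S)) fun P Q h => ?_
    exact Ideal.IsIntegral.comap_lt_comap h
  · refine iSup_le fun l => ?_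
    obtain ⟨P, hP1, hP2⟩ := Ideal.nonempty_primesOver (S := S) l.head.asIdeal
    obtain ⟨m, hm, -⟩ := Ideal.exists_ltSeries_of_hasGoingUp l P
    rw [← hm]
    exact Order.LTSeries.length_le_krullDim m

/-- The Krull dimension of a domain of finite type over a field is its transcendence degree. -/
theorem exists_ringKrullDim_eq_trdeg (K S : Type u) [Field K] [CommRing S] [IsDomain S]
    [Algebra K S] [Algebra.FiniteType K S] :
    ∃ d : ℕ, Algebra.trdeg K S = d ∧ ringKrullDim S = d := by
  -- Noether normalization: the number `s` of variables is both the dimension and the transcendence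
  -- degree.
  obtain ⟨s, g, hg, hi⟩ := exists_integral_inj_algHom_of_fg K S
  let := g.toRingHom.toAlgebra
  have : IsScalarTower K (MvPolynomial (Fin s) K) S := .of_algebraMap_eq' g.comp_algebraMap.symm
  have : Algebra.IsIntegral (MvPolynomial (Fin s) K) S := ⟨hi⟩
  have : FaithfulSMul (MvPolynomial (Fin s) K) S := (faithfulSMul_iff_algebraMap_injective _ _).2 hg
  refine ⟨s, ?_, ?_⟩
  · rw [← _root_.trdeg_add_eq K (MvPolynomial (Fin s) K) (A := S),
      trdeg_eq_zero (R := MvPolynomial (Fin s) K)]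
    simp
  · rw [ringKrullDim_eq_of_isIntegral (MvPolynomial (Fin s) K) S]
    simp

/-- The generic fibre of an injective map of finite type between domains has dimension the
transcendence degree. -/
theorem exists_ringKrullDim_localization_eq_trdeg (R S : Type u) [CommRing R] [CommRing S]
    [IsDomain R] [IsDomain S] [Algebra R S] [FaithfulSMul R S] [Algebra.FiniteType R S] :
    ∃ d : ℕ, Algebra.trdeg R S = d ∧
      ringKrullDim (Localization (Algebra.algebraMapSubmonoid S (nonZeroDivisors R))) = d := by
  let K := FractionRing R
  have hM : Algebra.algebraMapSubmonoid S (nonZeroDivisors R) ≤ nonZeroDivisors S :=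
    map_le_nonZeroDivisors_of_injective _ (FaithfulSMul.algebraMap_injective R S) le_rfl
  let T := Localization (Algebra.algebraMapSubmonoid S (nonZeroDivisors R))
  have : IsDomain T := IsLocalization.isDomain_localization hM
  have : FaithfulSMul S T :=
    (faithfulSMul_iff_algebraMap_injective _ _).2 (IsLocalization.injective T hM)
  have : FaithfulSMul R T := FaithfulSMul.trans R S T
  have : IsScalarTower R K T := inferInstance
  have : FaithfulSMul K T := (faithfulSMul_iff_algebraMap_injective _ _).2
    (localizationAlgebra_injective K T (FaithfulSMul.algebraMap_injective R S))
  have : Algebra.IsAlgebraic R K := IsLocalization.isAlgebraic K (nonZeroDivisors R)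
  have : Algebra.IsAlgebraic S T :=
    IsLocalization.isAlgebraic T (Algebra.algebraMapSubmonoid S (nonZeroDivisors R))
  have : IsLocalization ((nonZeroDivisors R).map (algebraMap R S)) T := inferInstanceAs
    (IsLocalization (Algebra.algebraMapSubmonoid S (nonZeroDivisors R)) T)
  have : Algebra.FiniteType K T := RingHom.finiteType_localizationPreserves (algebraMap R S)
    (nonZeroDivisors R) K T (RingHom.finiteType_algebraMap.2 inferInstance)
  obtain ⟨d, h1, h2⟩ := exists_ringKrullDim_eq_trdeg K T
  exact ⟨d, by rw [← h1, Algebra.trdeg_eq_of_isAlgebraic R S K T], h2⟩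

/-- The residue field extension at a generic point of a fibre of a standard smooth map of
relative dimension `m` has transcendence degree `m`. -/
theorem Algebra.IsStandardSmoothOfRelativeDimension.trdeg_quotient (R S : Type u) [CommRing R]
    [CommRing S] [Algebra R S] (m : ℕ) [Algebra.IsStandardSmoothOfRelativeDimension m R S]
    (p : Ideal R) (P : Ideal S) [P.IsPrime] [P.LiesOver p]
    (hP : ∀ P' : Ideal S, P'.IsPrime → P'.LiesOver p → P' ≤ P → P' = P) :
    Algebra.trdeg (R ⧸ p) (S ⧸ P) = m := by
  have : p.IsPrime := Ideal.over_def P p ▸ inferInstance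
  -- `S` is étale over a polynomial ring `A` in `m` variables. The aim is that `P` lies over the
  -- extended prime `Q = pA`, because `A ⧸ Q` has transcendence degree `m` over `R ⧸ p`.
  obtain ⟨g, hg⟩ := exists_etale_mvPolynomial m R S
  let A := MvPolynomial (Fin m) R
  let : Algebra A S := g.toRingHom.toAlgebra
  have : IsScalarTower R A S := .of_algebraMap_eq' g.comp_algebraMap.symm
  have : Algebra.Etale A S := hg
  let Q : Ideal A := p.map MvPolynomial.C
  let e : MvPolynomial (Fin m) (R ⧸ p) ≃ₐ[R] A ⧸ Q :=
    MvPolynomial.quotientEquivQuotientMvPolynomial p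
  have : IsDomain (A ⧸ Q) := e.toMulEquiv.symm.isDomain _
  have : Q.IsPrime := (Ideal.Quotient.isDomain_iff_prime Q).1 inferInstance
  have : Q.LiesOver p := by
    refine ⟨Ideal.ext fun r => ⟨fun h => Ideal.mem_map_of_mem _ h, fun h => ?_⟩⟩
    exact MvPolynomial.coeff_zero_C (σ := Fin m) r ▸ MvPolynomial.mem_map_C_iff.1 h 0
  have hle : Q ≤ P.under A := by
    rw [Ideal.map_le_iff_le_comap]
    intro r hr
    rw [Ideal.over_def P p] at hr
    change algebraMap A S (algebraMap R A r) ∈ P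
    rwa [← IsScalarTower.algebraMap_apply]
  -- Going down along `A → S` gives a prime below `P` lying over `Q`, hence over `p`. Minimality of
  -- `P` in its fibre identifies it with `P`.
  have : P.LiesOver Q := by
    obtain ⟨P', h1, h2, h3⟩ := Ideal.exists_ideal_le_liesOver_of_le (p := Q) (q := P.under A) P hle
    have := hP P' h2 (.trans P' Q p) h1
    exact this ▸ h3
  have : Algebra.QuasiFinite A (S ⧸ P) := .trans A S _
  have : Algebra.QuasiFinite (A ⧸ Q) (S ⧸ P) := .of_restrictScalars A _ _
  have := Algebra.QuasiFinite.isAlgebraic (A ⧸ Q) (S ⧸ P)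
  have : IsScalarTower (R ⧸ p) (A ⧸ Q) (S ⧸ P) := .of_algebraMap_eq fun r => by
    obtain ⟨r, rfl⟩ := Ideal.Quotient.mk_surjective r
    simp only [Ideal.Quotient.algebraMap_mk_of_liesOver, ← IsScalarTower.algebraMap_apply]
  let e' : MvPolynomial (Fin m) (R ⧸ p) ≃ₐ[R ⧸ p] A ⧸ Q := AlgEquiv.ofRingEquiv (f := e.toRingEquiv)
    fun r => by
      obtain ⟨r, rfl⟩ := Ideal.Quotient.mk_surjective r
      exact e.commutes r
  rw [← _root_.trdeg_add_eq (R ⧸ p) (A ⧸ Q) (A := S ⧸ P),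
    trdeg_eq_zero (R := A ⧸ Q),
    add_zero]
  simpa using e'.symm.trdeg_eq

end Trdeg

/-! ### Descent of finite type along smooth ring maps. -/

section Descent

open TensorProduct

/-- If the tensor product of an algebra with `S` is finitely generated, then its generators come
from a finitely generated subalgebra. -/
theorem exists_finset_tensorProduct_map_surjective (A R B S : Type u) [CommRing A] [CommRing R]
    [CommRing B] [CommRing S] [Algebra A R] [Algebra R B] [Algebra A B] [IsScalarTower A R B]
    [Algebra R S] [Algebra.FiniteType A (B ⊗[R] S)] :
    ∃ F : Finset B, Function.Surjective
      (Algebra.TensorProduct.map (Algebra.adjoin R (F : Set B)).val (AlgHom.id R S)) := by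
  classical
  have : IsScalarTower A R (B ⊗[R] S) := .of_algebraMap_eq fun a => by
    rw [IsScalarTower.algebraMap_apply A B (B ⊗[R] S), IsScalarTower.algebraMap_apply A R B,
      ← IsScalarTower.algebraMap_apply R B (B ⊗[R] S)]
  obtain ⟨G, hG⟩ := ‹Algebra.FiniteType A (B ⊗[R] S)›.out
  choose H hH using fun t : B ⊗[R] S => TensorProduct.exists_finset t
  -- Left tensor factors of the members of a finite generating set over `A`.
  refine ⟨G.biUnion fun t => (H t).image Prod.fst, ?_⟩
  rw [← AlgHom.range_eq_top, ← top_le_iff]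
  set N := (Algebra.TensorProduct.map (Algebra.adjoin R
    ((G.biUnion fun t => (H t).image Prod.fst : Finset B) : Set B)).val (AlgHom.id R S)).range
  have hN : (G : Set (B ⊗[R] S)) ⊆ N.restrictScalars A := by
    intro t ht
    rw [hH t]
    refine Subalgebra.sum_mem _ fun i hi => ?_
    exact ⟨(⟨i.1, Algebra.subset_adjoin (by simpa using ⟨t, ht, i.2, hi⟩)⟩ :
      Algebra.adjoin R _) ⊗ₜ i.2, by simp⟩
  intro t _
  exact Algebra.adjoin_le hN (hG ▸ Algebra.mem_top : t ∈ Algebra.adjoin A (G : Set (B ⊗[R] S)))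

/-- If `S` is flat over `R` and a submodule `N` of `M` becomes everything after tensoring with `S`,
then some power of each `r : R` whose basic open set lies in the image of `Spec S` multiplies any
given element into `N`. -/
theorem exists_pow_smul_mem_of_rTensor_surjective (R S M : Type u) [CommRing R] [CommRing S]
    [Algebra R S] [Module.Flat R S] [AddCommGroup M] [Module R M] (N : Submodule R M)
    (hN : Function.Surjective (N.subtype.rTensor S)) (r : R)
    (hr : (PrimeSpectrum.basicOpen r : Set (PrimeSpectrum R)) ⊆
      Set.range (PrimeSpectrum.comap (algebraMap R S))) (m : M) :
    ∃ n : ℕ, r ^ n • m ∈ N := by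
  let f : R →ₗ[R] M ⧸ N := LinearMap.toSpanSingleton R _ (N.mkQ m)
  -- `J` consists of the `s` with `s • m ∈ N`. As `M ⧸ N` vanishes over `S`, flatness gives `JS =
  -- S`. So no prime in the image of `Spec S` contains `J`, and `r` lies in the radical of `J`.
  let J : Ideal R := LinearMap.ker f
  have hJ : ∀ s, s ∈ J ↔ s • m ∈ N := fun s => by
    simp [J, f, ← Submodule.Quotient.mk_smul]
  have h0 : (N.mkQ).rTensor S = 0 := by
    rw [← LinearMap.cancel_right hN, ← LinearMap.rTensor_comp, LinearMap.zero_comp]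
    have : N.mkQ ∘ₗ N.subtype = 0 := by ext; simp
    rw [this, LinearMap.rTensor_zero]
  have h1 : f.rTensor S = 0 := by
    have : f = N.mkQ ∘ₗ LinearMap.toSpanSingleton R _ m := by ext; simp [f]
    rw [this, LinearMap.rTensor_comp, h0, LinearMap.zero_comp]
  have hex : Function.Exact (J.subtype.rTensor S) (f.rTensor S) :=
    Module.Flat.rTensor_exact S (LinearMap.exact_subtype_ker_map f)
  have htop : J.map (algebraMap R S) = ⊤ := by
    rw [Ideal.eq_top_iff_one]
    obtain ⟨z, hz⟩ := (hex (1 ⊗ₜ 1)).1 (by rw [h1]; rfl)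
    have : ∀ z : J ⊗[R] S, TensorProduct.lid R S (J.subtype.rTensor S z) ∈
        J.map (algebraMap R S) := by
      intro z
      induction z with
      | zero => simp
      | add x y hx hy => simpa using add_mem hx hy
      | tmul x y =>
        simpa [Algebra.smul_def] using Ideal.mul_mem_right _ _ (Ideal.mem_map_of_mem _ x.2)
    have h := this z
    rw [hz] at h
    simpa using h
  have : r ∈ J.radical := by
    by_contra h
    rw [Ideal.radical_eq_sInf, Ideal.mem_sInf] at h
    push Not at h
    obtain ⟨p, ⟨hp, hp'⟩, hrp⟩ := h
    obtain ⟨P, hP⟩ := hr (a := ⟨p, hp'⟩) hrp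
    refine P.2.ne_top (top_le_iff.1 (htop ▸ Ideal.map_le_iff_le_comap.2 ?_))
    exact hp.trans_eq (congrArg PrimeSpectrum.asIdeal hP).symm
  obtain ⟨n, hn⟩ := this
  exact ⟨n, (hJ _).1 hn⟩

/-- Being of finite type descends along smooth ring maps, locally on the image. -/
theorem Algebra.Smooth.exists_finiteType_localizationAway (A B C : Type u) [CommRing A] [CommRing B]
    [CommRing C] [Algebra A B] [Algebra B C] [Algebra A C] [IsScalarTower A B C]
    [Algebra.Smooth B C] [Algebra.FiniteType A C] (y : Ideal B) (P : Ideal C) [P.IsPrime]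
    [P.LiesOver y] :
    ∃ b ∉ y, Algebra.FiniteType A (Localization.Away b) := by
  -- `C` is the base change to `B` of a smooth algebra `S` over a finitely generated `A`-subalgebra
  -- `R` of `B`. It remains to show that `B` is of finite type over `R` after inverting a suitable
  -- `r`.
  obtain ⟨R, S, _, _, hR, hS, ⟨e⟩⟩ := Algebra.Smooth.exists_subalgebra_fg A B C
  have : Algebra.FiniteType A (B ⊗[R] S) := .equiv ‹_› (e.restrictScalars A)
  obtain ⟨F, hF⟩ := exists_finset_tensorProduct_map_surjective A R B S
  let R' := Algebra.adjoin R (F : Set B)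
  let q : PrimeSpectrum S := PrimeSpectrum.comap
    (e.symm.toRingHom.comp (Algebra.TensorProduct.includeRight : S →ₐ[R] B ⊗[R] S).toRingHom)
    ⟨P, inferInstance⟩
  have hopen : IsOpen (Set.range (PrimeSpectrum.comap (algebraMap R S))) :=
    PrimeSpectrum.isOpenMap_comap_of_hasGoingDown_of_finitePresentation.isOpen_range
  obtain ⟨_, ⟨_, ⟨r, rfl⟩, rfl⟩, hr, hr'⟩ :=
    PrimeSpectrum.isBasis_basic_opens.exists_subset_of_mem_open (Set.mem_range_self q) hopen
  have hpow : ∀ β : B, ∃ n : ℕ, r ^ n • β ∈ R' := fun β =>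
    exists_pow_smul_mem_of_rTensor_surjective R S B R'.toSubmodule hF r hr' β
  let b : B := r
  refine ⟨b, fun hb => hr ?_, ?_⟩
  · rw [Ideal.over_def P y] at hb
    change e.symm (1 ⊗ₜ[R] algebraMap R S r) ∈ P
    have : (1 : B) ⊗ₜ[R] algebraMap R S r = algebraMap B (B ⊗[R] S) b := by
      rw [Algebra.algebraMap_eq_smul_one, TensorProduct.tmul_smul, TensorProduct.smul_tmul',
        Algebra.TensorProduct.algebraMap_apply, Algebra.smul_def, mul_one]
      rfl
    rw [this, AlgEquiv.commutes]
    exact hb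
  · let L := Localization.Away b
    -- Every element of `B` enters `R'` after multiplication by a power of `r`, so `1/r` generates
    -- `L` over `R'`.
    have : Algebra.FiniteType R' L := by
      refine ⟨⟨{IsLocalization.Away.invSelf b}, Algebra.eq_top_iff.2 fun x => ?_⟩⟩
      obtain ⟨k, β, hβ⟩ := IsLocalization.Away.surj b x
      obtain ⟨n, hn⟩ := hpow β
      have hinv : algebraMap B L b * IsLocalization.Away.invSelf b = 1 :=
        IsLocalization.Away.mul_invSelf b
      have hx : x = algebraMap R' L ⟨r ^ n • β, hn⟩ * IsLocalization.Away.invSelf b ^ (n + k) := by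
        have h : algebraMap R' L ⟨r ^ n • β, hn⟩ = algebraMap B L b ^ n * algebraMap B L β := by
          rw [IsScalarTower.algebraMap_apply R' B L, ← map_pow, ← map_mul]
          rfl
        calc x = x * (algebraMap B L b * IsLocalization.Away.invSelf b) ^ (n + k) := by
              rw [hinv, one_pow, mul_one]
          _ = _ := by rw [h, ← hβ]; ring
      rw [hx]
      have hmem : IsLocalization.Away.invSelf b ∈
          Algebra.adjoin R' (({IsLocalization.Away.invSelf b} : Finset L) : Set L) :=
        Algebra.subset_adjoin (Finset.mem_coe.2 (Finset.mem_singleton_self _))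
      exact Subalgebra.mul_mem _ (Subalgebra.algebraMap_mem _ _) (Subalgebra.pow_mem _ hmem _)
    have : Algebra.FiniteType R R' :=
      (Subalgebra.fg_iff_finiteType R').1 ⟨F, rfl⟩
    have : Algebra.FiniteType A R := (Subalgebra.fg_iff_finiteType R).1 hR
    have : Algebra.FiniteType R L := .trans (S := R') ‹_› ‹_›
    exact .trans (S := R) ‹_› ‹_›

end Descent

/-! ### Transcendence degrees of residue field extensions. -/

section ResidueTrdeg

/-- The maps `k` and `l` are isomorphisms of fields. They allow `K` and `L` to be scheme-theoretic
residue fields, which are only isomorphic to the algebraic ones. -/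
theorem Algebra.trdeg_eq_trdeg_quotient {R S K L : Type u} [CommRing R] [CommRing S]
    [Algebra R S] (p : Ideal R) (P : Ideal S) [p.IsPrime] [P.IsPrime] [P.LiesOver p] [Field K]
    [Field L] [Algebra K L] (k : p.ResidueField →+* K) (l : P.ResidueField →+* L)
    (hk : Function.Surjective k) (hl : Function.Surjective l)
    (hkl : ∀ r, algebraMap K L (k (algebraMap R p.ResidueField r)) =
      l (algebraMap S P.ResidueField (algebraMap R S r))) :
    Algebra.trdeg K L = Algebra.trdeg (R ⧸ p) (S ⧸ P) := by
  let : Algebra (R ⧸ p) K := (k.comp (algebraMap (R ⧸ p) p.ResidueField)).toAlgebra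
  let : Algebra (S ⧸ P) L := (l.comp (algebraMap (S ⧸ P) P.ResidueField)).toAlgebra
  let : Algebra (R ⧸ p) L := ((algebraMap K L).comp (algebraMap (R ⧸ p) K)).toAlgebra
  have : IsScalarTower (R ⧸ p) K L := .of_algebraMap_eq' rfl
  have : IsScalarTower (R ⧸ p) (S ⧸ P) L :=
    .of_algebraMap_eq' (Ideal.Quotient.ringHom_ext (RingHom.ext hkl))
  have h1 : Algebra.IsAlgebraic (R ⧸ p) p.ResidueField :=
    IsLocalization.isAlgebraic _ (nonZeroDivisors (R ⧸ p))
  have h2 : Algebra.IsAlgebraic (S ⧸ P) P.ResidueField :=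
    IsLocalization.isAlgebraic _ (nonZeroDivisors (S ⧸ P))
  have : Algebra.IsAlgebraic (R ⧸ p) K := h1.ringHom_of_comp_eq (RingHom.id (R ⧸ p)) k
    Function.injective_id hk rfl
  have : Algebra.IsAlgebraic (S ⧸ P) L := h2.ringHom_of_comp_eq (RingHom.id (S ⧸ P)) l
    Function.injective_id hl rfl
  have : FaithfulSMul (R ⧸ p) K := (faithfulSMul_iff_algebraMap_injective _ _).2
    (k.injective.comp p.injective_algebraMap_quotient_residueField)
  have : FaithfulSMul (S ⧸ P) L := (faithfulSMul_iff_algebraMap_injective _ _).2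
    (l.injective.comp P.injective_algebraMap_quotient_residueField)
  exact Algebra.trdeg_eq_of_isAlgebraic (R ⧸ p) (S ⧸ P) K L

namespace AlgebraicGeometry

/-- The transcendence degree of the residue field extension `κ(x) / κ(f x)`. -/
noncomputable def Scheme.Hom.residueTrdeg {X Y : Scheme.{u}} (f : X ⟶ Y) (x : X) : Cardinal.{u} :=
  letI := (f.residueFieldMap x).hom.toAlgebra
  Algebra.trdeg (Y.residueField (f x)) (X.residueField x)

theorem Scheme.Hom.residueTrdeg_comp {X Y Z : Scheme.{u}} (f : X ⟶ Y) (g : Y ⟶ Z) (x : X) :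
    (f ≫ g).residueTrdeg x = g.residueTrdeg (f x) + f.residueTrdeg x := by
  let : Algebra (Z.residueField (g (f x))) (Y.residueField (f x)) :=
    (g.residueFieldMap (f x)).hom.toAlgebra
  let : Algebra (Y.residueField (f x)) (X.residueField x) := (f.residueFieldMap x).hom.toAlgebra
  let : Algebra (Z.residueField (g (f x))) (X.residueField x) :=
    ((f ≫ g).residueFieldMap x).hom.toAlgebra
  have : IsScalarTower (Z.residueField (g (f x))) (Y.residueField (f x)) (X.residueField x) :=
    .of_algebraMap_eq fun z => congr($(Scheme.residueFieldMap_comp f g x) z)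
  exact (trdeg_add_eq (Z.residueField (g (f x))) (Y.residueField (f x))
    (A := X.residueField x)).symm

theorem Scheme.Hom.residueTrdeg_eq_zero {X Y : Scheme.{u}} (f : X ⟶ Y) [IsOpenImmersion f] (x : X) :
    f.residueTrdeg x = 0 := by
  let : Algebra (Y.residueField (f x)) (X.residueField x) := (f.residueFieldMap x).hom.toAlgebra
  have hs : Function.Surjective (algebraMap (Y.residueField (f x)) (X.residueField x)) :=
    (ConcreteCategory.bijective_of_isIso (f.residueFieldMap x)).2
  have : Algebra.IsAlgebraic (Y.residueField (f x)) (X.residueField x) :=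
    ⟨fun x => by obtain ⟨y, rfl⟩ := hs x; exact isAlgebraic_algebraMap y⟩
  exact trdeg_eq_zero

theorem residueTrdeg_specMap (R S : CommRingCat.{u}) [Algebra R S] (P : Spec S)
    (p : Ideal R) [P.asIdeal.LiesOver p] :
    (Spec.map (CommRingCat.ofHom (algebraMap R S))).residueTrdeg P =
      Algebra.trdeg (R ⧸ p) (S ⧸ P.asIdeal) := by
  let f := Spec.map (CommRingCat.ofHom (algebraMap R S))
  obtain rfl : p = (f P).asIdeal := Ideal.over_def P.asIdeal p
  have h1 : (f P).asIdeal.IsPrime := (f P).isPrime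
  have h2 : P.asIdeal.IsPrime := P.isPrime
  have hsq : (CommRingCat.ofHom (algebraMap R (f P).asIdeal.ResidueField) ≫
      (Scheme.Spec.residueFieldIso R (f P)).inv) ≫ f.residueFieldMap P =
      CommRingCat.ofHom (algebraMap R S) ≫ CommRingCat.ofHom (algebraMap S P.asIdeal.ResidueField) ≫
      (Scheme.Spec.residueFieldIso S P).inv := by
    rw [← Spec.map_inj]
    have h := f.SpecMap_residueFieldMap_fromSpecResidueField P
    rw [← Scheme.Spec.map_residueFieldIso_inv_eq_fromSpecResidueField,
      ← Scheme.Spec.map_residueFieldIso_inv_eq_fromSpecResidueField] at h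
    simp only [Spec.map_comp, Category.assoc] at h ⊢
    exact h
  let : Algebra ((Spec R).residueField (f P)) ((Spec S).residueField P) :=
    (f.residueFieldMap P).hom.toAlgebra
  exact Algebra.trdeg_eq_trdeg_quotient (f P).asIdeal P.asIdeal
    (Scheme.Spec.residueFieldIso R (f P)).inv.hom (Scheme.Spec.residueFieldIso S P).inv.hom
    (ConcreteCategory.bijective_of_isIso (Scheme.Spec.residueFieldIso R (f P)).inv).2
    (ConcreteCategory.bijective_of_isIso (Scheme.Spec.residueFieldIso S P).inv).2
    fun r => congr($hsq r)

theorem residueTrdeg_fromSpec {X Y : Scheme.{u}} (f : X ⟶ Y) {U : Y.Opens} {V : X.Opens}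
    (hU : IsAffineOpen U) (hV : IsAffineOpen V) (e : V ≤ f ⁻¹ᵁ U) [Algebra Γ(Y, U) Γ(X, V)]
    (he : algebraMap Γ(Y, U) Γ(X, V) = (f.appLE U V e).hom) (P : Spec Γ(X, V))
    (p : Ideal Γ(Y, U)) [P.asIdeal.LiesOver p] :
    f.residueTrdeg (hV.fromSpec P) = Algebra.trdeg (Γ(Y, U) ⧸ p) (Γ(X, V) ⧸ P.asIdeal) := by
  rw [← residueTrdeg_specMap, he, CommRingCat.ofHom_hom]
  -- The affine charts are open immersions and contribute zero, so both ways around the chart square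
  -- give the same degree.
  have h1 := hV.fromSpec.residueTrdeg_comp f P
  have h2 := (Spec.map (f.appLE U V e)).residueTrdeg_comp hU.fromSpec P
  rw [Scheme.Hom.residueTrdeg_eq_zero hV.fromSpec, add_zero] at h1
  rw [Scheme.Hom.residueTrdeg_eq_zero hU.fromSpec, zero_add,
    IsAffineOpen.SpecMap_appLE_fromSpec f hU hV e] at h2
  rw [← h1, h2]

end AlgebraicGeometry

end ResidueTrdeg

/-! ### Dimension of generic fibres. -/

section FibreDimension

/-- The Krull dimension of a space is bounded by the dimensions of the members of an open cover. -/
theorem topologicalKrullDim_le_of_forall_isOpenEmbedding {T : Type*} [TopologicalSpace T]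
    {d : WithBot ℕ∞} (h : ∀ t : T, ∃ (W : Type u) (_ : TopologicalSpace W) (k : W → T),
      Topology.IsOpenEmbedding k ∧ t ∈ Set.range k ∧ topologicalKrullDim W ≤ d) :
    topologicalKrullDim T ≤ d := by
  refine iSup_le fun l => ?_
  -- A point of the smallest member lies in every member, so the whole chain restricts strictly to
  -- an open set around it.
  obtain ⟨t, ht⟩ := l.head.isIrreducible.nonempty
  obtain ⟨W, _, k, hk, ⟨w, rfl⟩, hd⟩ := h t
  let e := IrreducibleCloseds.orderIsoOfIsOpenEmbedding k hk
  let m : LTSeries (IrreducibleCloseds W) := LTSeries.mk l.length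
    (fun i => e.symm ⟨l i, w, LTSeries.head_le l i ht⟩)
    (fun i j hij => e.symm.strictMono (Subtype.mk_lt_mk.2 (l.strictMono hij)))
  exact (Order.LTSeries.length_le_krullDim m).trans hd

/-- The primes of `S` containing `P` and lying over `p = P ∩ R` form the spectrum of a ring whose
dimension is the transcendence degree of `S ⧸ P` over `R ⧸ p`. -/
theorem exists_isEmbedding_primeSpectrum_generic_fibre (R S : Type u) [CommRing R] [CommRing S]
    [Algebra R S] [Algebra.FiniteType R S] (p : Ideal R) (P : Ideal S) [P.IsPrime]
    [P.LiesOver p] :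
    ∃ (d : ℕ) (T : Type u) (_ : CommRing T) (k : PrimeSpectrum T → PrimeSpectrum S),
      Algebra.trdeg (R ⧸ p) (S ⧸ P) = d ∧ ringKrullDim T = d ∧ Topology.IsEmbedding k ∧
      Set.range k = {Q | P ≤ Q.asIdeal ∧ Q.asIdeal.under R = p} := by
  have : p.IsPrime := Ideal.over_def P p ▸ inferInstance
  have : Algebra.FiniteType R (S ⧸ P) := .trans (S := S) ‹_› inferInstance
  have : Algebra.FiniteType (R ⧸ p) (S ⧸ P) := .of_restrictScalars_finiteType R _ _
  obtain ⟨d, h1, h2⟩ := exists_ringKrullDim_localization_eq_trdeg (R ⧸ p) (S ⧸ P)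
  -- Primes of `S ⧸ P` avoiding the nonzero elements of `R ⧸ p` are those contracting to `p`.
  let M := Algebra.algebraMapSubmonoid (S ⧸ P) (nonZeroDivisors (R ⧸ p))
  refine ⟨d, Localization M, inferInstance, PrimeSpectrum.comap (Ideal.Quotient.mk P) ∘
    PrimeSpectrum.comap (algebraMap (S ⧸ P) (Localization M)), h1, h2, ?_, ?_⟩
  · exact (PrimeSpectrum.isClosedEmbedding_comap_of_surjective _ _
      Ideal.Quotient.mk_surjective).isEmbedding.comp
      (PrimeSpectrum.localization_comap_isEmbedding (Localization M) M)
  · rw [Set.range_comp, PrimeSpectrum.localization_comap_range (Localization M) M]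
    ext Q
    constructor
    · rintro ⟨Q, hQ, rfl⟩
      have hPQ : P ≤ Q.asIdeal.comap (Ideal.Quotient.mk P) := fun x hx => by
        rw [Ideal.mem_comap, Ideal.Quotient.eq_zero_iff_mem.2 hx]
        exact zero_mem _
      refine ⟨hPQ, le_antisymm (fun r hr => ?_) ?_⟩
      · by_contra hrp
        refine Set.disjoint_left.1 hQ (Algebra.mem_algebraMapSubmonoid_of_mem
          (⟨Ideal.Quotient.mk p r, mem_nonZeroDivisors_of_ne_zero fun h => hrp ?_⟩ :
            nonZeroDivisors (R ⧸ p))) hr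
        exact Ideal.Quotient.eq_zero_iff_mem.1 h
      · exact (Ideal.over_def P p).trans_le (Ideal.comap_mono hPQ)
    · rintro ⟨hQ1, hQ2⟩
      obtain ⟨Q, rfl⟩ : Q ∈ Set.range (PrimeSpectrum.comap (Ideal.Quotient.mk P)) := by
        rw [range_comap_of_surjective _ _ Ideal.Quotient.mk_surjective, Ideal.mk_ker]
        exact hQ1
      refine ⟨Q, Set.disjoint_left.2 ?_, rfl⟩
      rintro _ ⟨a, ha, rfl⟩ haQ
      obtain ⟨r, rfl⟩ := Ideal.Quotient.mk_surjective a
      have hr : r ∈ p := hQ2 ▸ haQ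
      exact nonZeroDivisors.ne_zero ha (Ideal.Quotient.eq_zero_iff_mem.2 hr)

end FibreDimension

/-! ### Fibre dimension, smoothness and descent for schemes. -/

namespace AlgebraicGeometry

theorem fromSpec_apply_eq_iff {X Y : Scheme.{u}} (f : X ⟶ Y) {U : Y.Opens} {V : X.Opens}
    (hU : IsAffineOpen U) (hV : IsAffineOpen V) (e : V ≤ f ⁻¹ᵁ U) [Algebra Γ(Y, U) Γ(X, V)]
    (he : algebraMap Γ(Y, U) Γ(X, V) = (f.appLE U V e).hom) (P Q : Spec Γ(X, V)) :
    f (hV.fromSpec Q) = f (hV.fromSpec P) ↔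
      Q.asIdeal.under Γ(Y, U) = P.asIdeal.under Γ(Y, U) := by
  rw [← Scheme.Hom.comp_apply, ← Scheme.Hom.comp_apply, ← IsAffineOpen.SpecMap_appLE_fromSpec f hU
    hV e, Scheme.Hom.comp_apply, Scheme.Hom.comp_apply,
    hU.fromSpec.isOpenEmbedding.injective.eq_iff, Ideal.under, Ideal.under, he]
  exact PrimeSpectrum.ext_iff

theorem fromSpec_specializes_iff {X : Scheme.{u}} {V : X.Opens} (hV : IsAffineOpen V)
    (P Q : Spec Γ(X, V)) : hV.fromSpec P ⤳ hV.fromSpec Q ↔ P.asIdeal ≤ Q.asIdeal := by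
  rw [hV.fromSpec.isOpenEmbedding.isInducing.specializes_iff]
  exact (PrimeSpectrum.le_iff_specializes P Q).symm

/-- The dimension of the part of the closure of `η` lying over `h η` is the transcendence degree of
the residue field extension. -/
theorem exists_topologicalKrullDim_closure_inter_fibre {X Z : Scheme.{u}} (h : X ⟶ Z)
    [LocallyOfFiniteType h] (η : X) :
    ∃ d : ℕ, h.residueTrdeg η = d ∧
      topologicalKrullDim ↥(closure {η} ∩ h ⁻¹' {h η}) = d := by
  let T := ↥(closure {η} ∩ h ⁻¹' {h η})
  have key : ∀ t : T, ∃ (d : ℕ) (A : Type u) (_ : CommRing A) (k : PrimeSpectrum A → T),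
      h.residueTrdeg η = d ∧ ringKrullDim A = d ∧ Topology.IsOpenEmbedding k ∧ t ∈ Set.range k := by
    rintro ⟨t, ht1, ht2⟩
    have hηt : η ⤳ t := specializes_iff_mem_closure.2 ht1
    obtain ⟨U, hU, hxU, -⟩ :=
      exists_isAffineOpen_mem_and_subset (x := h t) (U := ⊤) trivial
    -- An open chart around `t` also contains its generalization `η`. Hence all charts have the same
    -- dimension, the transcendence degree at `η`.
    obtain ⟨V, hV, hxV, hVU⟩ :=
      exists_isAffineOpen_mem_and_subset (x := t) (U := h ⁻¹ᵁ U) hxU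
    let : Algebra Γ(Z, U) Γ(X, V) := (h.appLE U V hVU).hom.toAlgebra
    have : Algebra.FiniteType Γ(Z, U) Γ(X, V) := h.finiteType_appLE hU hV hVU
    have hηV : η ∈ V := hηt.mem_open V.2 hxV
    obtain ⟨P, rfl⟩ : η ∈ Set.range hV.fromSpec := hV.range_fromSpec ▸ hηV
    have : P.asIdeal.IsPrime := P.isPrime
    obtain ⟨d, A, _, k, h1, h2, h3, h4⟩ := exists_isEmbedding_primeSpectrum_generic_fibre
      Γ(Z, U) Γ(X, V) (P.asIdeal.under _) P.asIdeal
    have hmem : ∀ Q : Spec Γ(X, V), Q ∈ Set.range k ↔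
        hV.fromSpec Q ∈ closure {hV.fromSpec P} ∩ h ⁻¹' {h (hV.fromSpec P)} := by
      intro Q
      rw [Set.mem_inter_iff, ← specializes_iff_mem_closure, fromSpec_specializes_iff,
        Set.mem_preimage, Set.mem_singleton_iff, fromSpec_apply_eq_iff h hU hV hVU rfl]
      exact Set.ext_iff.1 h4 Q
    let k' : PrimeSpectrum A → T := fun a => ⟨hV.fromSpec (k a), (hmem _).1 ⟨a, rfl⟩⟩
    have hrange : Set.range k' = Subtype.val ⁻¹' (V : Set X) := by
      ext ⟨s, hs⟩
      constructor
      · rintro ⟨a, ha⟩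
        have : hV.fromSpec (k a) = s := congrArg Subtype.val ha
        exact hV.range_fromSpec.le ⟨k a, this⟩
      · intro hsV
        obtain ⟨Q, rfl⟩ : s ∈ Set.range hV.fromSpec := hV.range_fromSpec ▸ hsV
        obtain ⟨a, ha⟩ := (hmem Q).2 hs
        exact ⟨a, Subtype.ext (congrArg hV.fromSpec ha)⟩
    refine ⟨d, A, inferInstance, k', ?_, h2, ⟨?_, ?_⟩, ?_⟩
    · rw [residueTrdeg_fromSpec h hU hV hVU rfl P (P.asIdeal.under _), h1]
    · exact (hV.fromSpec.isOpenEmbedding.isEmbedding.comp h3).codRestrict _ _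
    · rw [hrange]
      exact V.2.preimage continuous_subtype_val
    · rw [hrange]
      exact hxV
  obtain ⟨d, A, _, k, h1, h2, h3, -⟩ := key ⟨η, subset_closure rfl, rfl⟩
  refine ⟨d, h1, le_antisymm ?_ ?_⟩
  · refine topologicalKrullDim_le_of_forall_isOpenEmbedding fun t => ?_
    obtain ⟨d', A', _, k', h1', h2', h3', h4'⟩ := key t
    refine ⟨_, _, k', h3', h4', ?_⟩
    rw [PrimeSpectrum.topologicalKrullDim_eq_ringKrullDim, h2']
    rw [h1, Nat.cast_inj] at h1'
    rw [h1']
  · rw [← h2, ← PrimeSpectrum.topologicalKrullDim_eq_ringKrullDim]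
    exact h3.isEmbedding.isInducing.topologicalKrullDim_le

/-- At a generic point of a fibre of a smooth morphism of relative dimension `m` the residue field
extension has transcendence degree `m`. -/
theorem residueTrdeg_eq_of_smoothOfRelativeDimension {X Y : Scheme.{u}} (f : X ⟶ Y) (m : ℕ)
    [hf : SmoothOfRelativeDimension m f] (η : X) (hη : ∀ η', η' ⤳ η → f η' = f η → η' = η) :
    f.residueTrdeg η = m := by
  obtain ⟨U, hU, V, hV, hηV, e, hs⟩ := hf.exists_isStandardSmoothOfRelativeDimension η
  algebraize [(f.appLE U V e).hom]
  obtain ⟨P, rfl⟩ : η ∈ Set.range hV.fromSpec := hV.range_fromSpec ▸ hηV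
  have : P.asIdeal.IsPrime := P.isPrime
  rw [residueTrdeg_fromSpec f hU hV e rfl P (P.asIdeal.under _)]
  refine Algebra.IsStandardSmoothOfRelativeDimension.trdeg_quotient _ _ m _ _ fun P' h1 h2 h3 => ?_
  let Q : Spec Γ(X, V) := ⟨P', h1⟩
  have := hη (hV.fromSpec Q) ((fromSpec_specializes_iff hV Q P).2 h3)
    ((fromSpec_apply_eq_iff f hU hV e rfl P Q).2 h2.over.symm)
  exact congrArg PrimeSpectrum.asIdeal (hV.fromSpec.isOpenEmbedding.injective this)

/-- Being locally of finite type descends along smooth surjective morphisms. -/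
theorem LocallyOfFiniteType.of_comp_of_smooth_of_surjective {X Y Z : Scheme.{u}} (f : X ⟶ Y)
    (g : Y ⟶ Z) [Smooth f] [Surjective f] [LocallyOfFiniteType (f ≫ g)] :
    LocallyOfFiniteType g := by
  rw [HasRingHomProperty.iff_exists_appLE (P := @LocallyOfFiniteType)
    (RingHom.finiteType_stableUnderComposition.stableUnderCompositionWithLocalizationAway
      RingHom.finiteType_holdsForLocalizationAway).1]
  intro y
  obtain ⟨x, rfl⟩ := f.surjective y
  obtain ⟨U, hU, hxU, -⟩ :=
    exists_isAffineOpen_mem_and_subset (x := g (f x)) (U := ⊤) trivial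
  obtain ⟨V, hV, hxV, hVU⟩ :=
    exists_isAffineOpen_mem_and_subset (x := f x) (U := g ⁻¹ᵁ U) hxU
  obtain ⟨W, hW, hxW, hWV⟩ :=
    exists_isAffineOpen_mem_and_subset (x := x) (U := f ⁻¹ᵁ V) hxV
  have hWU : W ≤ (f ≫ g) ⁻¹ᵁ U := hWV.trans (f.preimage_mono hVU)
  let : Algebra Γ(Z, U) Γ(Y, V) := (g.appLE U V hVU).hom.toAlgebra
  let : Algebra Γ(Y, V) Γ(X, W) := (f.appLE V W hWV).hom.toAlgebra
  let : Algebra Γ(Z, U) Γ(X, W) := ((f ≫ g).appLE U W hWU).hom.toAlgebra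
  have : IsScalarTower Γ(Z, U) Γ(Y, V) Γ(X, W) := .of_algebraMap_eq fun a =>
    congr($((Scheme.Hom.appLE_comp_appLE f g U V W hVU hWV).symm) a)
  have : Algebra.Smooth Γ(Y, V) Γ(X, W) := f.smooth_appLE hV hW hWV
  have : Algebra.FiniteType Γ(Z, U) Γ(X, W) := (f ≫ g).finiteType_appLE hU hW hWU
  obtain ⟨P, rfl⟩ : x ∈ Set.range hW.fromSpec := hW.range_fromSpec ▸ hxW
  have : P.asIdeal.IsPrime := P.isPrime
  obtain ⟨b, hb, hfin⟩ := Algebra.Smooth.exists_finiteType_localizationAway Γ(Z, U) Γ(Y, V) Γ(X, W)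
    (P.asIdeal.under _) P.asIdeal
  have e : Y.basicOpen b ≤ g ⁻¹ᵁ U := (Y.basicOpen_le b).trans hVU
  refine ⟨⟨U, hU⟩, ⟨Y.basicOpen b, hV.basicOpen b⟩, ?_, e, ?_⟩
  · have h : (Spec.map (f.appLE V W hWV)) P ∈ PrimeSpectrum.basicOpen b := hb
    rw [← hV.fromSpec_preimage_basicOpen] at h
    change hV.fromSpec _ ∈ Y.basicOpen b at h
    rwa [← Scheme.Hom.comp_apply, IsAffineOpen.SpecMap_appLE_fromSpec f hV hW hWV] at h
  · have := hV.isLocalization_basicOpen b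
    let φ := IsLocalization.algEquiv (.powers b) (Localization.Away b) Γ(Y, Y.basicOpen b)
    have h1 : (algebraMap Γ(Z, U) (Localization.Away b)).FiniteType :=
      RingHom.finiteType_algebraMap.2 hfin
    have h2 := (RingHom.FiniteType.of_surjective φ.toRingEquiv.toRingHom φ.surjective).comp h1
    convert h2
    rw [← g.appLE_map hVU (homOfLE (Y.basicOpen_le b)).op, CommRingCat.hom_comp,
      IsScalarTower.algebraMap_eq Γ(Z, U) Γ(Y, V) (Localization.Away b), ← RingHom.comp_assoc]
    congr 1
    ext a
    exact (φ.commutes a).symm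

end AlgebraicGeometry

/-! ### Points without proper generalizations in a closed set. -/

/-- The generic points of the maximal irreducible subsets of a closed set are its points without
proper generalizations in that set. -/
theorem maximal_isIrreducible_subset_iff {T : Type*} [TopologicalSpace T] [QuasiSober T]
    [T0Space T] {F : Set T} (hF : IsClosed F) {S : Set T} {η : T} :
    Maximal (fun A : Set T => IsIrreducible A ∧ A ⊆ F) S ∧ IsGenericPoint η S ↔
      closure {η} = S ∧ η ∈ F ∧ ∀ η', η' ⤳ η → η' ∈ F → η' = η := by
  constructor
  · rintro ⟨hS, rfl⟩
    refine ⟨rfl, hS.prop.2 (subset_closure rfl), fun η' h1 h2 => ?_⟩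
    have h3 := hS.le_of_ge (y := closure {η'})
      ⟨isIrreducible_singleton.closure, closure_minimal (Set.singleton_subset_iff.2 h2) hF⟩
      h1.closure_subset
    exact (h1.antisymm (specializes_iff_closure_subset.2 h3)).eq
  · rintro ⟨rfl, h1, h2⟩
    refine ⟨⟨⟨isIrreducible_singleton.closure, closure_minimal (Set.singleton_subset_iff.2 h1) hF⟩,
      fun A hA hle => ?_⟩, rfl⟩
    obtain ⟨η', hη'⟩ := QuasiSober.sober hA.1.closure isClosed_closure
    have h3 : η' ∈ closure A := hη'.mem
    have h4 : η' ⤳ η := hη'.specializes (subset_closure (hle (subset_closure rfl)))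
    obtain rfl := h2 η' h4 (closure_minimal hA.2 hF h3)
    exact hη'.def.symm ▸ subset_closure

/-- Every point of a closed set is a specialization of a point without proper generalizations in
that set. -/
theorem exists_specializes_forall_specializes_eq {T : Type*} [TopologicalSpace T] [QuasiSober T]
    [T0Space T] {F : Set T} (hF : IsClosed F) {x : T} (hx : x ∈ F) :
    ∃ η, η ⤳ x ∧ η ∈ F ∧ ∀ η', η' ⤳ η → η' ∈ F → η' = η := by
  let e : F → T := Subtype.val
  have he : Topology.IsClosedEmbedding e := hF.isClosedEmbedding_subtypeVal
  have : QuasiSober F := he.quasiSober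
  -- `η` is the generic point of an irreducible component of `F` through `x`.
  obtain ⟨η, hη⟩ := QuasiSober.sober (isIrreducible_irreducibleComponent (x := (⟨x, hx⟩ : F)))
    isClosed_irreducibleComponent
  refine ⟨η, (hη.specializes mem_irreducibleComponent).map continuous_subtype_val, η.2,
    fun η' h1 h2 => ?_⟩
  have h3 : (⟨η', h2⟩ : F) ⤳ η := he.isInducing.specializes_iff.1 h1
  have h4 := eq_irreducibleComponent (x := (⟨x, hx⟩ : F)) (s := closure {⟨η', h2⟩})
    isIrreducible_singleton.closure.isPreirreducible
    (hη.def.symm.le.trans h3.closure_subset)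
  have h5 : (⟨η', h2⟩ : F) = η := (h3.antisymm (specializes_iff_closure_subset.2
    (by rw [h4, ← hη.def]))).eq
  exact congrArg Subtype.val h5

/-! ### Relative dimension under composition with a smooth morphism. -/

namespace RelDim

theorem IsUniversallyCatenary.of_locallyOfFiniteType {X Y : Scheme.{u}}
    (hY : IsUniversallyCatenary Y) (f : X ⟶ Y) [LocallyOfFiniteType f] :
    IsUniversallyCatenary X where
  isLocallyNoetherian :=
    have := hY.isLocallyNoetherian
    LocallyOfFiniteType.isLocallyNoetherian f
  isCatenary W g _ := hY.isCatenary W (g ≫ f) inferInstance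

/-- Relative dimension at least `n` in terms of transcendence degrees of residue fields. -/
theorem hasRelDimGE_iff {X Y : Scheme.{u}} {f : X ⟶ Y} {n : ℤ} :
    HasRelDimGE f n ↔ IsUniversallyCatenary Y ∧ LocallyOfFiniteType f ∧
      ∀ (Y' : Set Y) (η : X), IsIrreducible Y' → IsClosed Y' → f η ∈ Y' →
        (∀ η', η' ⤳ η → f η' ∈ Y' → η' = η) →
        ∃ d c : ℕ, f.residueTrdeg η = d ∧ codim Y' (closure {f η}) = c ∧ n ≤ (d : ℤ) - c := by
  have himage : ∀ η : X, closure (f '' closure {η}) = closure {f η} := fun η => by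
    rw [closure_image_closure f.continuous, Set.image_singleton]
  constructor
  · rintro ⟨-, h2, h3, h4⟩
    refine ⟨h2, h3, fun Y' η h5 h6 h7 h8 => ?_⟩
    obtain ⟨h9, h10⟩ := (maximal_isIrreducible_subset_iff (h6.preimage f.continuous)).2
      ⟨rfl, h7, h8⟩
    obtain ⟨d, c, hd, hc, hn⟩ := h4 Y' _ η h5 h6 h9 h10
    obtain ⟨d', h11, h12⟩ := exists_topologicalKrullDim_closure_inter_fibre f η
    have : d = d' := by exact_mod_cast hd.symm.trans h12
    exact ⟨d, c, this ▸ h11, himage η ▸ hc, hn⟩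
  · rintro ⟨h2, h3, h4⟩
    refine ⟨h2.of_locallyOfFiniteType f, h2, h3, fun Y' X' η h5 h6 h7 h8 => ?_⟩
    obtain ⟨rfl, h9, h10⟩ := (maximal_isIrreducible_subset_iff (h6.preimage f.continuous)).1
      ⟨h7, h8⟩
    obtain ⟨d, c, hd, hc, hn⟩ := h4 Y' η h5 h6 h9 h10
    obtain ⟨d', h11, h12⟩ := exists_topologicalKrullDim_closure_inter_fibre f η
    have : d = d' := by exact_mod_cast hd.symm.trans h11
    exact ⟨d, c, this ▸ h12, (himage η).symm ▸ hc, hn⟩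

section Composition

variable {X Y Z : Scheme.{u}} {f : X ⟶ Y} {g : Y ⟶ Z} {m : ℕ} {n : ℤ}

theorem HasRelDimGE.comp_of_smooth (hg : HasRelDimGE g n) (hf : SmoothOfRelativeDimension m f) :
    HasRelDimGE (f ≫ g) (n + m) := by
  have := SmoothOfRelativeDimension.smooth m f
  obtain ⟨h1, h2, h3⟩ := hasRelDimGE_iff.1 hg
  refine hasRelDimGE_iff.2 ⟨h1, inferInstance, fun Z' η h4 h5 h6 h7 => ?_⟩
  -- A generalization of `f η` in the preimage of `Z'` lifts to one of `η`, which must be `η`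
  -- itself.
  obtain ⟨d, c, hd, hc, hn⟩ := h3 Z' (f η) h4 h5 h6 fun ξ h8 h9 => by
    obtain ⟨η', h10, rfl⟩ := Flat.generalizingMap f h8
    rw [h7 η' h10 h9]
  refine ⟨d + m, c, ?_, hc, by push_cast; linarith⟩
  rw [Scheme.Hom.residueTrdeg_comp, hd, residueTrdeg_eq_of_smoothOfRelativeDimension f m η
    fun η' h8 h9 => h7 η' h8 (by rwa [Scheme.Hom.comp_apply, h9])]
  push_cast
  rfl

theorem HasRelDimGE.of_comp_of_smooth [Surjective f] (hfg : HasRelDimGE (f ≫ g) (n + m))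
    (hf : SmoothOfRelativeDimension m f) : HasRelDimGE g n := by
  have := SmoothOfRelativeDimension.smooth m f
  obtain ⟨h1, h2, h3⟩ := hasRelDimGE_iff.1 hfg
  refine hasRelDimGE_iff.2 ⟨h1, .of_comp_of_smooth_of_surjective f g, fun Z' ξ h4 h5 h6 h7 => ?_⟩
  obtain ⟨x, rfl⟩ := f.surjective ξ
  -- Any such `η` maps to a generalization of `f x`, hence to `f x` itself, so `η` detects the data
  -- of `g` there.
  obtain ⟨η, h8, h9, h10⟩ := exists_specializes_forall_specializes_eq
    (h5.preimage (f ≫ g).continuous) (x := x) h6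
  have hη : f η = f x := h7 _ (h8.map f.continuous) h9
  obtain ⟨d, c, hd, hc, hn⟩ := h3 Z' η h4 h5 h9 h10
  rw [Scheme.Hom.residueTrdeg_comp, hη, residueTrdeg_eq_of_smoothOfRelativeDimension f m η
    fun η' h8 h9' => h10 η' h8 (by
      rw [Set.mem_preimage, Scheme.Hom.comp_apply, h9']; exact h9)] at hd
  rw [Scheme.Hom.comp_apply, hη] at hc
  -- Only the sum with `m` is known to be a natural number; the summand is bounded by it.
  obtain ⟨d', hd'⟩ := Cardinal.lt_aleph0.1
    ((self_le_add_right (g.residueTrdeg (f x)) (m : Cardinal)).trans_lt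
      (hd.trans_lt Cardinal.natCast_lt_aleph0))
  rw [hd'] at hd
  have : d' + m = d := by exact_mod_cast hd
  exact ⟨d', c, hd', hc, by rw [← this] at hn; push_cast at hn; linarith⟩

/-- The base change of a composition factors through a base change of the first morphism. -/
theorem exists_isPullback_comp_pullback_snd (f : X ⟶ Y) (g : Y ⟶ Z) {S : Scheme.{u}} (b : S ⟶ Z) :
    ∃ f' : pullback (f ≫ g) b ⟶ pullback g b, f' ≫ pullback.snd g b = pullback.snd (f ≫ g) b ∧
      IsPullback (pullback.fst (f ≫ g) b) f' f (pullback.fst g b) := by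
  let f' : pullback (f ≫ g) b ⟶ pullback g b :=
    pullback.lift (pullback.fst (f ≫ g) b ≫ f) (pullback.snd (f ≫ g) b)
      (by rw [Category.assoc, pullback.condition])
  have h1 : f' ≫ pullback.snd g b = pullback.snd (f ≫ g) b := pullback.lift_snd _ _ _
  refine ⟨f', h1, .flip (.of_right ?_ (pullback.lift_fst _ _ _) (IsPullback.of_hasPullback g b).flip)⟩
  rw [h1]
  exact (IsPullback.of_hasPullback (f ≫ g) b).flip

theorem HasUnivRelDimGE.comp_of_smooth (hg : HasUnivRelDimGE g n)
    (hf : SmoothOfRelativeDimension m f) : HasUnivRelDimGE (f ≫ g) (n + m) := fun S b hS => by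
  obtain ⟨f', h1, h2⟩ := exists_isPullback_comp_pullback_snd f g b
  have := smoothOfRelativeDimension_isStableUnderBaseChange m
  exact h1 ▸ (hg S b hS).comp_of_smooth (MorphismProperty.of_isPullback h2 hf)

theorem HasUnivRelDimGE.of_comp_of_smooth [hs : Surjective f] (hfg : HasUnivRelDimGE (f ≫ g) (n + m))
    (hf : SmoothOfRelativeDimension m f) : HasUnivRelDimGE g n := fun S b hS => by
  obtain ⟨f', h1, h2⟩ := exists_isPullback_comp_pullback_snd f g b
  have := smoothOfRelativeDimension_isStableUnderBaseChange m
  have : Surjective f' := MorphismProperty.of_isPullback (P := @Surjective) h2 hs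
  exact HasRelDimGE.of_comp_of_smooth (f := f') (h1 ▸ hfg S b hS)
    (MorphismProperty.of_isPullback h2 hf)

end Composition

/-! ### Passage to neighbourhoods of a point. -/

/-- A property of morphisms with target `Z`, indexed by integers, that ascends and descends along
smooth morphisms with a shift by the relative dimension does so at points. -/
theorem exists_opens_iff_of_smooth {X Y Z : Scheme.{u}} (f : X ⟶ Y) (g : Y ⟶ Z) [Smooth f] (x : X)
    (n : ℤ) (P : ∀ {W : Scheme.{u}}, (W ⟶ Z) → ℤ → Prop)
    (comp : ∀ {V W : Scheme.{u}} {f : V ⟶ W} {g : W ⟶ Z} {m : ℕ} {n : ℤ}, P g n →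
      SmoothOfRelativeDimension m f → P (f ≫ g) (n + m))
    (of_comp : ∀ {V W : Scheme.{u}} {f : V ⟶ W} {g : W ⟶ Z} {m : ℕ} {n : ℤ} [Surjective f],
      P (f ≫ g) (n + m) → SmoothOfRelativeDimension m f → P g n) :
    (∃ V : Y.Opens, f x ∈ V ∧ P (V.ι ≫ g) n) ↔
      ∃ U : X.Opens, x ∈ U ∧ P (U.ι ≫ f ≫ g) (n + reldim f x) := by
  obtain ⟨U₀, hxU₀, hU₀⟩ := reldim_spec f x
  have hsub {U : X.Opens} (hU : U ≤ U₀) : SmoothOfRelativeDimension (reldim f x) (U.ι ≫ f) := by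
    rw [← X.homOfLE_ι hU, Category.assoc, ← Nat.zero_add (reldim f x)]
    infer_instance
  have hlift {U : X.Opens} {V : Y.Opens} (hU : U ≤ U₀) (hUV : U ≤ f ⁻¹ᵁ V) :
      SmoothOfRelativeDimension (reldim f x) (f.resLE V U hUV) := by
    -- A property stable under base change can be cancelled against the monomorphism `V.ι`.
    have := smoothOfRelativeDimension_isStableUnderBaseChange.{u} (reldim f x)
    have := MorphismProperty.IsStableUnderBaseChange.hasOfPostcompProperty_monomorphisms
      (P := @SmoothOfRelativeDimension.{u} (reldim f x))
    exact MorphismProperty.of_postcomp (W := @SmoothOfRelativeDimension.{u} (reldim f x))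
      (W' := MorphismProperty.monomorphisms _) _ V.ι (inferInstanceAs (Mono V.ι))
      (f.resLE_comp_ι hUV ▸ hsub hU)
  constructor
  · rintro ⟨V, hxV, hV⟩
    have hUV : U₀ ⊓ f ⁻¹ᵁ V ≤ f ⁻¹ᵁ V := inf_le_right
    refine ⟨U₀ ⊓ f ⁻¹ᵁ V, ⟨hxU₀, hxV⟩, ?_⟩
    rw [← Category.assoc, ← Scheme.Hom.resLE_comp_ι f hUV, Category.assoc]
    exact comp hV (hlift inf_le_left hUV)
  · rintro ⟨U, hxU, hU⟩
    let U₁ := U ⊓ U₀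
    -- The image of `U₁` is open, and taking it as target makes the restriction of `f` surjective.
    let V : Y.Opens := ⟨f '' U₁, f.isOpenMap _ U₁.2⟩
    have hUV : U₁ ≤ f ⁻¹ᵁ V := fun y hy => ⟨y, hy, rfl⟩
    refine ⟨V, ⟨x, ⟨hxU, hxU₀⟩, rfl⟩, ?_⟩
    have : Surjective (f.resLE V U₁ hUV) := by
      refine ⟨?_⟩
      rintro ⟨_, y, hy, rfl⟩
      refine ⟨⟨y, hy⟩, V.ι.isOpenEmbedding.injective ?_⟩
      exact congr($(f.resLE_comp_ι hUV) (⟨y, hy⟩ : U₁))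
    refine of_comp (f := f.resLE V U₁ hUV) ?_ (hlift inf_le_right hUV)
    rw [← Category.assoc, Scheme.Hom.resLE_comp_ι, ← X.homOfLE_ι (inf_le_left : U₁ ≤ U),
      Category.assoc, Category.assoc]
    -- Restriction to `U₁` is the ascent property for an open immersion, smooth of relative
    -- dimension `0`.
    have hU₁ := comp (f := X.homOfLE (inf_le_left : U₁ ≤ U)) (m := 0) hU inferInstance
    rwa [Nat.cast_zero, add_zero] at hU₁

end RelDim

theorem mainTheorem4 {X Y Z : Scheme.{u}} (f : X ⟶ Y) (g : Y ⟶ Z) (hf : Smooth f)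
    (hZ : RelDim.IsUniversallyCatenary Z) (x : X) (n : ℤ) :
    (RelDim.HasRelDimGEAt g n (f x) ↔
      RelDim.HasRelDimGEAt (f ≫ g) (n + (RelDim.reldim f x : ℤ)) x) ∧
    (RelDim.HasUnivRelDimGEAt g n (f x) ↔
      RelDim.HasUnivRelDimGEAt (f ≫ g) (n + (RelDim.reldim f x : ℤ)) x) :=
  ⟨RelDim.exists_opens_iff_of_smooth f g x n RelDim.HasRelDimGE
    RelDim.HasRelDimGE.comp_of_smooth RelDim.HasRelDimGE.of_comp_of_smooth,
  RelDim.exists_opens_iff_of_smooth f g x n RelDim.HasUnivRelDimGE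
    RelDim.HasUnivRelDimGE.comp_of_smooth RelDim.HasUnivRelDimGE.of_comp_of_smooth⟩
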